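/- Let $d\ge 1$ and let $U\subset\mathbb{R}^d$ be a bounded Lipschitz domain, i.e. a bounded open set such that near each point of $\partial U$, after a rigid motion, $U$ is the region strictly below the graph of a Lipschitz function of $d-1$ variables (connectedness is not required). Then there are constants $C_1,C_2>0$, depending only on $U$, such that for every continuous monotone function $f:\overline U\to\mathbb{R}$ $$\limsup_{h\searrow 0}\; C_1\sum_{\substack{c\in\mathcal C_h\\ c\cap\overline U\neq\emptyset}}\mathrm{MVar}(f;c)\,h^{d-1}\;\le\;\mathrm{Var}(f;U),$$ and for all $h>0$ $$\mathrm{Var}(f;U)\;\le\; C_2\sum_{\substack{c\in\mathcal C_h\\ c\cap\overline U\neq\emptyset}}\mathrm{MVar}(f;c)\,h^{d-1}.$$ Here: * $\mathcal C_h=\big\{\prod_{i=1}^d[z_i,z_i+h] : z\in h\mathbb{Z}^d\big\}$ is the set of grid cubes of side $h$. * $f$ is monotone if there is $s\in\{-1,1\}^d$ such that $f(x)\le f(y)$ for all $x,y\in\overline U$ with $s\odot x\le s\odot y$, where $\odot$ is componentwise multiplication and $\le$ is the componentwise order. * For $A\subset\mathbb{R}^d$, the M-variation of $f$ on $A$ is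 $$\mathrm{MVar}(f;A)=\inf\sum_{s\in\{-1,1\}^d}\Big(\sup_{x\in A}f_s(s\odot x)-\inf_{x\in A}f_s(s\odot x)\Big),$$ where the infimum is over all families of componentwise nondecreasing functions $f_s:\mathbb{R}^d\to\mathbb{R}$ with $f(x)=\sum_{s}f_s(s\odot x)$ for all $x\in A$. As $f$ is defined on $\overline U$ only, $\mathrm{MVar}(f;c)$ means $\mathrm{MVar}(f;c\cap\overline U)$ for a cube $c$. * The total variation is $\mathrm{Var}(f;U)=\sup\big\{\int_U f\,\mathrm{div}\,\varphi\,dx : \varphi\in C_c^1(U;\mathbb{R}^d),\ |\varphi(x)|\le 1 \text{ for all } x\big\}$, with $|\cdot|$ the Euclidean norm. -/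

import Mathlib

open Set Filter Topology MeasureTheory
open scoped ENNReal NNReal RealInnerProductSpace

noncomputable section

namespace MVariation

/-- The space `ℝ^d` with the Euclidean norm. -/
abbrev Space (d : ℕ) : Type := EuclideanSpace ℝ (Fin d)

/-- The directions of monotonicity `{-1, 1}^d`. -/
abbrev SignVec (d : ℕ) : Type := Fin d → ℤˣ

/-- Componentwise multiplication `s ⊙ x` of a point by a sign vector. -/
def signMul {d : ℕ} (s : SignVec d) (x : Space d) : Space d :=
  WithLp.toLp 2 (fun i => ((s i : ℤ) : ℝ) * x i)

/-- `f` is nondecreasing on `A` with respect to `s`: if `x, y ∈ A` and `s ⊙ x ≤ s ⊙ y`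
componentwise, then `f x ≤ f y`. -/
def NondecreasingWrt {d : ℕ} (s : SignVec d) (f : Space d → ℝ) (A : Set (Space d)) : Prop :=
  ∀ x ∈ A, ∀ y ∈ A, (∀ i, signMul s x i ≤ signMul s y i) → f x ≤ f y

/-- `f` is monotone on `A`: it is nondecreasing with respect to some direction of monotonicity. -/
def IsMonotoneOn {d : ℕ} (f : Space d → ℝ) (A : Set (Space d)) : Prop :=
  ∃ s : SignVec d, NondecreasingWrt s f A

/-- `g : ℝ^d → ℝ` is nondecreasing for the componentwise order. -/
def Nondecreasing {d : ℕ} (g : Space d → ℝ) : Prop :=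
  ∀ x y : Space d, (∀ i, x i ≤ y i) → g x ≤ g y

/-- `F` is a monotone decomposition of `f` on `A`: each `F s : ℝ^d → ℝ` is nondecreasing, and
`f x = ∑ s, F s (s ⊙ x)` for all `x ∈ A`. -/
def IsMonoDecomp {d : ℕ} (f : Space d → ℝ) (A : Set (Space d))
    (F : SignVec d → Space d → ℝ) : Prop :=
  (∀ s, Nondecreasing (F s)) ∧ ∀ x ∈ A, f x = ∑ s, F s (signMul s x)

/-- `sup_A g - inf_A g`, as an element of `[0, ∞]` (it is `0` for empty `A`). -/
def supSubInf {d : ℕ} (g : Space d → ℝ) (A : Set (Space d)) : ℝ≥0∞ :=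
  ((⨆ x ∈ A, (g x : EReal)) - ⨅ x ∈ A, (g x : EReal)).toENNReal

/-- The M-variation of `f` on `A`: the infimum over all monotone decompositions of the sum of
`sup - inf` of the parts. It is `∞` if there is no decomposition. -/
def MVar {d : ℕ} (f : Space d → ℝ) (A : Set (Space d)) : ℝ≥0∞ :=
  ⨅ (F : SignVec d → Space d → ℝ) (_ : IsMonoDecomp f A F),
    ∑ s, supSubInf (fun x => F s (signMul s x)) A

/-- The divergence of a vector field. -/
def divergence {d : ℕ} (φ : Space d → Space d) (x : Space d) : ℝ :=
  ∑ i, fderiv ℝ φ x (EuclideanSpace.single i 1) i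

/-- The total variation of `f` in the open set `U`: the supremum of `∫_U f div φ` over all
`φ ∈ C_c^1(U; ℝ^d)` with `|φ| ≤ 1`. (The supremum is nonnegative, as `φ = 0` is admissible.) -/
def totalVar {d : ℕ} (f : Space d → ℝ) (U : Set (Space d)) : ℝ≥0∞ :=
  ⨆ (φ : Space d → Space d)
    (_ : ContDiff ℝ 1 φ ∧ HasCompactSupport φ ∧ tsupport φ ⊆ U ∧ ∀ x, ‖φ x‖ ≤ 1),
    ENNReal.ofReal (∫ x in U, f x * divergence φ x)

/-- `U` is open with Lipschitz boundary: near each boundary point `p`, and for a suitable unit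
vector `e`, it is the set of points whose `e`-coordinate lies below the graph of a Lipschitz
function of the coordinates orthogonal to `e`. Connectedness is not required. -/
def IsLipschitzDomain {d : ℕ} (U : Set (Space d)) : Prop :=
  IsOpen U ∧ ∀ p ∈ frontier U, ∃ e : Space d, ‖e‖ = 1 ∧
    ∃ r : ℝ, 0 < r ∧ ∃ (K : ℝ≥0) (g : (ℝ ∙ e)ᗮ → ℝ), LipschitzWith K g ∧
      ∀ x ∈ Metric.ball p r, x ∈ U ↔ ⟪e, x⟫ < g ((ℝ ∙ e)ᗮ.orthogonalProjectionOnto x)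

/-- The grid cubes `∏ i, [z_i, z_i + h]` with `z ∈ h ℤ^d`. -/
def gridCubes (d : ℕ) (h : ℝ) : Set (Set (Space d)) :=
  {c | ∃ z : Fin d → ℤ, c = {x | ∀ i, h * z i ≤ x i ∧ x i ≤ h * z i + h}}

/-- The sum of `MVar(f; c) h^(d-1)` over the grid cubes `c` of side `h` that meet the closure
of `U`. As `f` lives on the closure of `U`, the M-variation on `c` is that on
`c ∩ closure U`. -/
def gridMVarSum {d : ℕ} (f : Space d → ℝ) (U : Set (Space d)) (h : ℝ) : ℝ≥0∞ :=
  ∑' c : {c : Set (Space d) // c ∈ gridCubes d h ∧ (c ∩ closure U).Nonempty},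
    MVar f (c.1 ∩ closure U) * ENNReal.ofReal h ^ (d - 1)

end MVariation

end

/-!
A monotone function has M-variation equal to its oscillation on every set, because it extends
monotonically to the whole space and may serve as the only nonzero part of a decomposition. So the
grid sum is a sum of oscillations over cubes, and, after multiplication by `h`, the integral over
`x` of the oscillation on the cube of `x` (`gridMVarSum_mul_eq_lintegral`).

**Upper bound for the variation**, with `C₂ = 2 d`. The integral of `f ∂ᵢφᵢ` is the limit of
difference quotients of `φᵢ` with step `t = h / N`, which translation invariance moves onto `f`:
what matters is `N` times the integral of `|f (x + t eᵢ) - f x|` over the support of `φ`, that is,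
the integral over `x` of a sum of `N` consecutive increments on the segment from `x` to `x + h eᵢ`.
This segment lies in two adjacent cubes. As `f` is monotone, the increments telescope once the
values of a monotone extension of `f` are clamped to the range of `f` on each of the two cubes; this
gives the sum of the two oscillations (`sum_increments_le`).

**Lower bound**, with `C₁ = 1 / (2 d)`. If the cube of `x` is far from the complement of `U`, then
monotonicity bounds the oscillation on it by `f (x + h s) - f (x - h s)`, where `s` is the direction
of monotonicity of `f`. The integral of this increment is at most `2 h √d Var(f; U)`, by testing the
variation with translates of a cutoff function times `h s` (`lintegral_increment_le_totalVar`). The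
remaining cubes lie within a distance of order `h` of the boundary of `U`. This boundary layer has
volume of order `h` (`IsLipschitzDomain.exists_volume_thickening_frontier_le`, the only place where
the Lipschitz condition enters), and by uniform continuity the oscillations there tend to `0`, so the
contribution of these cubes vanishes in the limit `h → 0`.
-/

namespace MVariation

variable {d : ℕ}

/-! ### The M-variation of a monotone function is its oscillation -/

lemma supSubInf_le_ofReal {g : Space d → ℝ} {A : Set (Space d)} {M : ℝ}
    (h : ∀ x ∈ A, ∀ y ∈ A, g x - g y ≤ M) : supSubInf g A ≤ ENNReal.ofReal M := by
  unfold supSubInf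
  rcases A.eq_empty_or_nonempty with rfl | ⟨a, ha⟩
  · simp
  have hlow : ((sSup (g '' A) - M : ℝ) : EReal) ≤ ⨅ x ∈ A, (g x : EReal) := by
    refine le_iInf₂ fun y hy => EReal.coe_le_coe_iff.2 ?_
    have : sSup (g '' A) ≤ g y + M := csSup_le ⟨_, a, ha, rfl⟩ (by
      rintro _ ⟨x, hx, rfl⟩
      linarith [h x hx y hy])
    linarith
  have hup : (⨆ x ∈ A, (g x : EReal)) ≤ ((sSup (g '' A) : ℝ) : EReal) := by
    refine iSup₂_le fun x hx => EReal.coe_le_coe_iff.2 (le_csSup ⟨g a + M, ?_⟩ ⟨x, hx, rfl⟩)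
    rintro _ ⟨y, hy, rfl⟩
    linarith [h y hy a ha]
  rw [← EReal.real_coe_toENNReal]
  refine EReal.toENNReal_le_toENNReal ((EReal.sub_le_sub hup hlow).trans ?_)
  rw [← EReal.coe_sub]
  exact EReal.coe_le_coe_iff.2 (by linarith)

lemma ofReal_sub_le_supSubInf {g : Space d → ℝ} {A : Set (Space d)} {x y : Space d}
    (hx : x ∈ A) (hy : y ∈ A) : ENNReal.ofReal (g x - g y) ≤ supSubInf g A := by
  rw [← EReal.real_coe_toENNReal, EReal.coe_sub]
  exact EReal.toENNReal_le_toENNReal (EReal.sub_le_sub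
    (le_iSup₂ (f := fun x (_ : x ∈ A) => (g x : EReal)) x hx)
    (iInf₂_le (f := fun x (_ : x ∈ A) => (g x : EReal)) y hy))

lemma ofReal_sub_le_MVar {f : Space d → ℝ} {A : Set (Space d)} {x y : Space d}
    (hx : x ∈ A) (hy : y ∈ A) : ENNReal.ofReal (f x - f y) ≤ MVar f A := by
  refine le_iInf₂ fun F hF => ?_
  rw [hF.2 x hx, hF.2 y hy, ← Finset.sum_sub_distrib]
  refine (Finset.le_sum_of_subadditive _ ENNReal.ofReal_zero.le
    (fun _ _ => ENNReal.ofReal_add_le) _ _).trans ?_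
  exact Finset.sum_le_sum fun s _ =>
    ofReal_sub_le_supSubInf (g := fun x => F s (signMul s x)) hx hy

lemma MVar_empty (f : Space d → ℝ) : MVar f ∅ = 0 := by
  refine le_antisymm (iInf₂_le_of_le (fun _ _ => 0) ⟨fun _ _ _ _ => le_rfl, by simp⟩ ?_) bot_le
  simp [supSubInf]

lemma signMul_apply (s : SignVec d) (x : Space d) (i : Fin d) :
    signMul s x i = ((s i : ℤ) : ℝ) * x i := rfl

lemma sign_mul_self (s : SignVec d) (i : Fin d) :
    ((s i : ℤ) : ℝ) * ((s i : ℤ) : ℝ) = 1 := by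
  rcases Int.units_eq_one_or (s i) with h | h <;> simp [h]

lemma signMul_signMul (s : SignVec d) (x : Space d) : signMul s (signMul s x) = x := by
  ext i
  rw [signMul_apply, signMul_apply, ← mul_assoc, sign_mul_self, one_mul]

/-- A bounded function that is nondecreasing with respect to `s` on `A` extends to the whole space
without losing this property. -/
lemma NondecreasingWrt.exists_extension {s : SignVec d} {f : Space d → ℝ} {A : Set (Space d)}
    (hf : NondecreasingWrt s f A) (hl : BddBelow (f '' A)) (hu : BddAbove (f '' A)) :
    ∃ g : Space d → ℝ, NondecreasingWrt s g univ ∧ EqOn g f A := by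
  obtain ⟨m, hm⟩ := hl
  obtain ⟨M, hM⟩ := hu
  set S : Space d → Set ℝ := fun x =>
    insert m (f '' {y | y ∈ A ∧ ∀ i, signMul s y i ≤ signMul s x i}) with hS
  have hbdd : ∀ x, BddAbove (S x) := fun x => by
    refine ⟨max m M, ?_⟩
    rintro _ (rfl | ⟨y, hy, rfl⟩)
    · exact le_max_left _ _
    · exact le_max_of_le_right (hM ⟨y, hy.1, rfl⟩)
  refine ⟨fun x => sSup (S x), fun x _ y _ hxy => ?_, fun x hx => ?_⟩
  · refine csSup_le_csSup (hbdd y) ⟨m, mem_insert _ _⟩ (insert_subset_insert (image_mono ?_))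
    exact fun z hz => ⟨hz.1, fun i => (hz.2 i).trans (hxy i)⟩
  · refine le_antisymm (csSup_le ⟨m, mem_insert _ _⟩ ?_)
      (le_csSup (hbdd x) (mem_insert_of_mem _ ⟨x, ⟨hx, fun _ => le_rfl⟩, rfl⟩))
    rintro _ (rfl | ⟨y, hy, rfl⟩)
    · exact hm ⟨x, hx, rfl⟩
    · exact hf y hy.1 x hx hy.2

lemma NondecreasingWrt.MVar_le_supSubInf {s : SignVec d} {f : Space d → ℝ} {A : Set (Space d)}
    (hf : NondecreasingWrt s f A) (hl : BddBelow (f '' A)) (hu : BddAbove (f '' A)) :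
    MVar f A ≤ supSubInf f A := by
  obtain ⟨g, hg, hgf⟩ := hf.exists_extension hl hu
  classical
  refine iInf₂_le_of_le
    (Function.update (fun _ _ => 0) s (fun x => g (signMul s x))) ⟨fun t => ?_, fun x hx => ?_⟩ ?_
  · rcases eq_or_ne t s with rfl | hts
    · intro x y hxy
      simp only [Function.update_self]
      exact hg _ trivial _ trivial fun i => by simpa [signMul_signMul] using hxy i
    · intro x y hxy
      simp [Function.update_of_ne hts]
  · rw [Finset.sum_eq_single s (fun t _ hts => by simp [Function.update_of_ne hts]) (by simp)]
    simp [signMul_signMul, hgf hx]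
  · rw [Finset.sum_eq_single s (fun t _ hts => ?_) (by simp)]
    · simp only [Function.update_self, signMul_signMul]
      unfold supSubInf
      refine le_of_eq ?_
      congr 2
      · exact iSup_congr fun x => iSup_congr fun hx => congrArg _ (hgf hx)
      · exact iInf_congr fun x => iInf_congr fun hx => congrArg _ (hgf hx)
    · simp only [Function.update_of_ne hts]
      simpa using supSubInf_le_ofReal (g := fun _ : Space d => (0 : ℝ)) (A := A) (M := 0) (by simp)

lemma NondecreasingWrt.MVar_le_ofReal {s : SignVec d} {f : Space d → ℝ} {A : Set (Space d)} {M : ℝ}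
    (hf : NondecreasingWrt s f A) (h : ∀ x ∈ A, ∀ y ∈ A, f x - f y ≤ M) :
    MVar f A ≤ ENNReal.ofReal M := by
  rcases A.eq_empty_or_nonempty with rfl | ⟨a, ha⟩
  · simp [MVar_empty]
  refine (hf.MVar_le_supSubInf ⟨f a - M, ?_⟩ ⟨f a + M, ?_⟩).trans (supSubInf_le_ofReal h)
  · rintro _ ⟨x, hx, rfl⟩
    linarith [h a ha x hx]
  · rintro _ ⟨x, hx, rfl⟩
    linarith [h x hx a ha]

/-- Truncation of the values of `f` to their range on `A`: the clamp is monotone, does not change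
the values on `A`, and has total oscillation at most the M-variation of `f` on `A`. -/
lemma exists_clamp {f : Space d → ℝ} {A : Set (Space d)}
    (hl : BddBelow (f '' A)) (hu : BddAbove (f '' A)) :
    ∃ γ : ℝ → ℝ, Monotone γ ∧ (∀ x ∈ A, γ (f x) = f x) ∧
      ∀ u v, ENNReal.ofReal (γ u - γ v) ≤ MVar f A := by
  rcases A.eq_empty_or_nonempty with rfl | hA
  · exact ⟨fun _ => 0, fun _ _ _ => le_rfl, by simp, by simp⟩
  have hne : (f '' A).Nonempty := hA.image f
  refine ⟨fun u => max (sInf (f '' A)) (min u (sSup (f '' A))), fun u v huv => by dsimp; gcongr,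
    fun x hx => ?_, fun u v => ?_⟩
  · simp only
    rw [min_eq_left (le_csSup hu ⟨x, hx, rfl⟩), max_eq_right (csInf_le hl ⟨x, hx, rfl⟩)]
  · have hle : sInf (f '' A) ≤ sSup (f '' A) := csInf_le_csSup hne hl hu
    have h1 : max (sInf (f '' A)) (min u (sSup (f '' A))) -
        max (sInf (f '' A)) (min v (sSup (f '' A))) ≤ sSup (f '' A) - sInf (f '' A) :=
      sub_le_sub (max_le hle (min_le_right _ _)) (le_max_left _ _)
    refine (ENNReal.ofReal_le_ofReal h1).trans ?_
    rcases eq_or_ne (MVar f A) ∞ with htop | htop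
    · simp [htop]
    refine ENNReal.ofReal_le_of_le_toReal ?_
    have h2 : ∀ x ∈ A, ∀ y ∈ A, f x - f y ≤ (MVar f A).toReal := fun x hx y hy =>
      (ENNReal.ofReal_le_iff_le_toReal htop).1 (ofReal_sub_le_MVar hx hy)
    have h3 : ∀ y ∈ A, sSup (f '' A) - (MVar f A).toReal ≤ f y := fun y hy => by
      have : sSup (f '' A) ≤ f y + (MVar f A).toReal := csSup_le hne (by
        rintro _ ⟨x, hx, rfl⟩
        linarith [h2 x hx y hy])
      linarith
    have h4 : sSup (f '' A) - (MVar f A).toReal ≤ sInf (f '' A) := le_csInf hne (by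
      rintro _ ⟨y, hy, rfl⟩
      exact h3 y hy)
    linarith

/-! ### Grid cubes -/

/-- The closed grid cube of side `h` with lower corner `h z`. -/
def gridCube (h : ℝ) (z : Fin d → ℤ) : Set (Space d) :=
  {x | ∀ i, h * z i ≤ x i ∧ x i ≤ h * z i + h}

/-- The index of the half-open grid cube of side `h` that contains `x`. -/
noncomputable def cellIndex (h : ℝ) (x : Space d) : Fin d → ℤ := fun i => ⌊x i / h⌋

lemma cellIndex_eq_iff {h : ℝ} (hh : 0 < h) {x : Space d} {z : Fin d → ℤ} :
    cellIndex h x = z ↔ ∀ i, h * z i ≤ x i ∧ x i < h * z i + h := by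
  rw [funext_iff]
  refine forall_congr' fun i => ?_
  rw [cellIndex, Int.floor_eq_iff, le_div_iff₀ hh, div_lt_iff₀ hh]
  constructor <;> rintro ⟨h1, h2⟩ <;> constructor <;> linarith

lemma mem_gridCube_cellIndex {h : ℝ} (hh : 0 < h) (x : Space d) :
    x ∈ gridCube h (cellIndex h x) := fun i =>
  have := (cellIndex_eq_iff hh).1 (rfl : cellIndex h x = _) i
  ⟨this.1, this.2.le⟩

lemma gridCube_injective {h : ℝ} (hh : 0 < h) :
    Function.Injective (gridCube h : (Fin d → ℤ) → Set (Space d)) := by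
  have key : ∀ z w : Fin d → ℤ, gridCube h z = gridCube h w → ∀ i, w i ≤ z i := by
    intro z w hzw i
    -- the lower corner of the first cube lies in the second one
    have : WithLp.toLp 2 (fun i => h * (z i : ℝ)) ∈ (gridCube h z : Set (Space d)) :=
      fun i => ⟨le_rfl, by simp [hh.le]⟩
    rw [hzw] at this
    exact_mod_cast le_of_mul_le_mul_left (this i).1 hh
  exact fun z w hzw => funext fun i => le_antisymm (key w z hzw.symm i) (key z w hzw i)

lemma dist_le_of_mem_gridCube {h : ℝ} (hh : 0 < h) {z : Fin d → ℤ} {x y : Space d}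
    (hx : x ∈ gridCube h z) (hy : y ∈ gridCube h z) : dist x y ≤ √d * h := by
  rw [EuclideanSpace.dist_eq, ← Real.sqrt_sq hh.le, ← Real.sqrt_mul (Nat.cast_nonneg d)]
  refine Real.sqrt_le_sqrt ?_
  calc ∑ i, dist (x i) (y i) ^ 2 ≤ ∑ _i : Fin d, h ^ 2 := by
        refine Finset.sum_le_sum fun i _ => ?_
        rw [Real.dist_eq, sq_abs]
        have := hx i
        have := hy i
        exact sq_le_sq' (by linarith) (by linarith)
    _ = d * h ^ 2 := by simp

lemma measurable_cellIndex (h : ℝ) : Measurable (cellIndex h : Space d → Fin d → ℤ) := by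
  refine measurable_pi_lambda _ fun i => Int.measurable_floor.comp ?_
  fun_prop

lemma volume_cellIndex_preimage {h : ℝ} (hh : 0 < h) (z : Fin d → ℤ) :
    volume ((cellIndex h : Space d → Fin d → ℤ) ⁻¹' {z}) = ENNReal.ofReal h ^ d := by
  have : (cellIndex h : Space d → Fin d → ℤ) ⁻¹' {z} =
      WithLp.ofLp ⁻¹' (univ.pi fun i => Ico (h * (z i : ℝ)) (h * z i + h)) := by
    ext x
    simp [cellIndex_eq_iff hh]
  rw [this, (PiLp.volume_preserving_ofLp (Fin d)).measure_preimage
    (MeasurableSet.univ_pi fun i => measurableSet_Ico).nullMeasurableSet, volume_pi_pi]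
  simp

lemma lintegral_cellIndex {h : ℝ} (hh : 0 < h) (O : (Fin d → ℤ) → ℝ≥0∞) :
    ∫⁻ x : Space d, O (cellIndex h x) = ∑' z, O z * ENNReal.ofReal h ^ d := by
  rw [← lintegral_map (measurable_of_countable O) (measurable_cellIndex h), lintegral_countable']
  refine tsum_congr fun z => ?_
  rw [Measure.map_apply (measurable_cellIndex h) (measurableSet_singleton z),
    volume_cellIndex_preimage hh]

lemma gridMVarSum_eq_tsum (f : Space d → ℝ) (U : Set (Space d)) {h : ℝ} (hh : 0 < h) :
    gridMVarSum f U h =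
      ∑' z : Fin d → ℤ, MVar f (gridCube h z ∩ closure U) * ENNReal.ofReal h ^ (d - 1) := by
  unfold gridMVarSum
  set φ : Set (Space d) → ℝ≥0∞ :=
    fun c => MVar f (c ∩ closure U) * ENNReal.ofReal h ^ (d - 1) with hφ
  have h1 : (∑' c : {c : Set (Space d) // c ∈ gridCubes d h ∧ (c ∩ closure U).Nonempty}, φ c.1) =
      ∑' c : range (gridCube h : (Fin d → ℤ) → Set (Space d)), φ c.1 := by
    refine (tsum_subtype {c : Set (Space d) | c ∈ gridCubes d h ∧ (c ∩ closure U).Nonempty} φ).trans ?_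
    rw [tsum_subtype (range (gridCube h)) φ]
    refine tsum_congr fun c => ?_
    have hc : c ∈ gridCubes d h ↔ c ∈ range (gridCube h : (Fin d → ℤ) → Set (Space d)) :=
      ⟨fun ⟨z, hz⟩ => ⟨z, hz.symm⟩, fun ⟨z, hz⟩ => ⟨z, hz.symm⟩⟩
    by_cases hcr : c ∈ range (gridCube h : (Fin d → ℤ) → Set (Space d))
    · rcases (c ∩ closure U).eq_empty_or_nonempty with he | hne
      · simp [indicator, hφ, he, MVar_empty]
      · rw [indicator_of_mem hcr, indicator_of_mem (show c ∈ {c | c ∈ gridCubes d h ∧ (c ∩ closure U).Nonempty} from ⟨hc.2 hcr, hne⟩)]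
    · rw [indicator_of_notMem hcr, indicator_of_notMem fun hm => hcr (hc.1 hm.1)]
  rw [h1]
  exact tsum_range φ (gridCube_injective hh)

lemma gridMVarSum_mul_eq_lintegral (hd : 1 ≤ d) (f : Space d → ℝ) (U : Set (Space d)) {h : ℝ}
    (hh : 0 < h) :
    gridMVarSum f U h * ENNReal.ofReal h =
      ∫⁻ x : Space d, MVar f (gridCube h (cellIndex h x) ∩ closure U) := by
  rw [gridMVarSum_eq_tsum f U hh, lintegral_cellIndex hh (fun z => MVar f (gridCube h z ∩ closure U)),
    ← ENNReal.tsum_mul_right]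
  refine tsum_congr fun z => ?_
  rw [mul_assoc, ← pow_succ, Nat.sub_add_cancel hd]

/-! ### Differentiation of translates under the integral -/

lemma hasDerivAt_integral_mul_translate {F η : Space d → ℝ} (hF : Integrable F)
    (hη : ContDiff ℝ 1 η) (hηc : HasCompactSupport η) (w : Space d) (τ : ℝ) :
    Integrable (fun y => F y * fderiv ℝ η (y + τ • w) w) ∧
      HasDerivAt (fun τ : ℝ => ∫ y, F y * η (y + τ • w))
        (∫ y, F y * fderiv ℝ η (y + τ • w) w) τ := by
  have hcd : Continuous (fderiv ℝ η) := hη.continuous_fderiv one_ne_zero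
  obtain ⟨C, hC⟩ := hcd.bounded_above_of_compact_support (hηc.fderiv ℝ)
  obtain ⟨C₀, hC₀⟩ := hη.continuous.bounded_above_of_compact_support hηc
  have hcont : ∀ σ : ℝ, Continuous fun y : Space d => η (y + σ • w) := fun σ =>
    hη.continuous.comp (by fun_prop)
  have hmeas : ∀ σ : ℝ, AEStronglyMeasurable (fun y : Space d => F y * η (y + σ • w)) :=
    fun σ => hF.aestronglyMeasurable.mul (hcont σ).aestronglyMeasurable
  refine hasDerivAt_integral_of_dominated_loc_of_deriv_le (s := univ)
    (bound := fun y => ‖F y‖ * (C * ‖w‖))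
    (F := fun (σ : ℝ) y => F y * η (y + σ • w))
    (F' := fun (σ : ℝ) y => F y * fderiv ℝ η (y + σ • w) w) univ_mem (Eventually.of_forall hmeas) ?_ ?_ ?_
    (hF.norm.mul_const _) ?_
  · exact hF.mul_bdd (hcont τ).aestronglyMeasurable (Eventually.of_forall fun y => hC₀ _)
  · refine hF.aestronglyMeasurable.mul (Continuous.aestronglyMeasurable ?_)
    exact (hcd.comp (by fun_prop : Continuous fun y : Space d => y + τ • w)).clm_apply
      continuous_const
  · refine Eventually.of_forall fun y σ _ => ?_
    rw [norm_mul]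
    gcongr
    exact (ContinuousLinearMap.le_opNorm _ _).trans (by gcongr; exact hC _)
  · refine Eventually.of_forall fun y σ _ => HasDerivAt.const_mul _ ?_
    have h1 : HasDerivAt (fun σ : ℝ => y + σ • w) w σ := by
      simpa using ((hasDerivAt_id σ).smul_const w).const_add y
    exact ((hη.differentiable one_ne_zero _).hasFDerivAt).comp_hasDerivAt σ h1

/-! ### The total variation is bounded by the grid sums -/

/-- Cut the segment of length `h` from `x` in direction `e_i` into `N` steps. The increments of `f`
over the steps that start in `K`, which stay inside `U`, add up to at most the M-variations on the grid
cube of `x` and on its upper neighbour in direction `i`: clamp a monotone extension of `f` to the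
range of `f` on each cube, and telescope. -/
lemma sum_increments_le {s : SignVec d} {f : Space d → ℝ} {U K : Set (Space d)}
    (hf : NondecreasingWrt s f (closure U)) (hl : BddBelow (f '' closure U))
    (hu : BddAbove (f '' closure U)) {h t : ℝ} (hh : 0 < h) (ht : 0 ≤ t) {N : ℕ}
    (hN : N * t = h) (i : Fin d)
    (hK : ∀ x ∈ K, ∀ r ∈ Icc 0 t, x + r • EuclideanSpace.single i (1 : ℝ) ∈ U) (x : Space d) :
    ∑ k ∈ Finset.range N, K.indicator
        (fun y => ‖f (y + t • EuclideanSpace.single i (1 : ℝ)) - f y‖ₑ)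
        (x + (k * t) • EuclideanSpace.single i (1 : ℝ)) ≤
      MVar f (gridCube h (cellIndex h x) ∩ closure U) +
        MVar f (gridCube h (cellIndex h x + Pi.single i 1) ∩ closure U) := by
  set e : Space d := EuclideanSpace.single i (1 : ℝ) with he
  set z := cellIndex h x with hz
  have hei : ∀ r : ℝ, ∀ j, (x + r • e) j = x j + if j = i then r else 0 := fun r j => by
    simp only [he, PiLp.add_apply, PiLp.smul_apply, PiLp.single_apply, smul_eq_mul]
    split_ifs <;> simp
  have hxz := (cellIndex_eq_iff hh).1 hz.symm
  have hlow : ∀ r : ℝ, 0 ≤ r → x i + r ≤ h * z i + h → x + r • e ∈ gridCube h z := by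
    intro r hr hr' j
    rw [hei]
    have := hxz j
    split_ifs with hj
    · subst hj
      constructor <;> linarith
    · constructor <;> linarith
  have hhigh : ∀ r : ℝ, r ≤ h → h * z i + h ≤ x i + r →
      x + r • e ∈ gridCube h (z + Pi.single i 1) := by
    intro r hr hr' j
    rw [hei]
    have := hxz j
    rcases eq_or_ne j i with rfl | hj
    · simp only [Pi.add_apply, Pi.single_eq_same, if_true]
      push_cast
      constructor <;> linarith
    · simp only [Pi.add_apply, Pi.single_eq_of_ne hj, if_neg hj]
      push_cast
      constructor <;> linarith
  obtain ⟨F, hF, hFf⟩ := hf.exists_extension hl hu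
  obtain ⟨γ, hγ, hγf, hγo⟩ := exists_clamp (f := f) (A := gridCube h z ∩ closure U)
    (hl.mono (image_mono inter_subset_right)) (hu.mono (image_mono inter_subset_right))
  obtain ⟨γ', hγ', hγf', hγo'⟩ := exists_clamp (f := f)
    (A := gridCube h (z + Pi.single i 1) ∩ closure U)
    (hl.mono (image_mono inter_subset_right)) (hu.mono (image_mono inter_subset_right))
  set ε : ℝ := ((s i : ℤ) : ℝ) with hε
  -- multiplication by the sign `ε` turns the direction of monotonicity along `e_i` into increase
  have hmono : ∀ β : ℝ → ℝ, Monotone β → Monotone fun r : ℝ => ε * β (F (x + r • e)) := by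
    intro β hβ r r' hrr
    rcases Int.units_eq_one_or (s i) with hs | hs
    · simp only [hε, hs, Units.val_one, Int.cast_one, one_mul]
      refine hβ (hF _ trivial _ trivial fun j => ?_)
      rw [signMul_apply, signMul_apply, hei, hei]
      split_ifs with hj
      · simpa [hj, hs] using hrr
      · exact le_rfl
    · simp only [hε, hs, Units.val_neg, Units.val_one, Int.cast_neg, Int.cast_one, neg_mul, one_mul,
        neg_le_neg_iff]
      refine hβ (hF _ trivial _ trivial fun j => ?_)
      rw [signMul_apply, signMul_apply, hei, hei]
      split_ifs with hj
      · simpa [hj, hs] using hrr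
      · exact le_rfl
  have hεosc : ∀ (β : ℝ → ℝ) (B : ℝ≥0∞), (∀ u v, ENNReal.ofReal (β u - β v) ≤ B) →
      ∀ u v, ENNReal.ofReal (ε * β u - ε * β v) ≤ B := by
    intro β B hβ u v
    rcases Int.units_eq_one_or (s i) with hs | hs
    · simpa [hε, hs] using hβ u v
    · simpa [hε, hs, neg_add_eq_sub] using hβ v u
  have hγm := hmono γ hγ
  have hγm' := hmono γ' hγ'
  set D : ℕ → ℝ := fun k => ε * γ (F (x + (k * t) • e)) with hD
  set D' : ℕ → ℝ := fun k => ε * γ' (F (x + (k * t) • e)) with hD'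
  have hkt : ∀ k : ℕ, (k : ℝ) * t ≤ ((k + 1 : ℕ) : ℝ) * t := fun k => by
    push_cast; nlinarith
  have hDm : ∀ k, 0 ≤ D (k + 1) - D k := fun k => sub_nonneg.2 (hγm (hkt k))
  have hDm' : ∀ k, 0 ≤ D' (k + 1) - D' k := fun k => sub_nonneg.2 (hγm' (hkt k))
  have hstep : ∀ k ∈ Finset.range N, K.indicator (fun y => ‖f (y + t • e) - f y‖ₑ)
      (x + (k * t) • e) ≤ ENNReal.ofReal ((D (k + 1) - D k) + (D' (k + 1) - D' k)) := by
    intro k hk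
    by_cases hkK : x + (k * t) • e ∈ K
    swap
    · simp [indicator_of_notMem hkK]
    rw [indicator_of_mem hkK, Real.enorm_eq_ofReal_abs]
    refine ENNReal.ofReal_le_ofReal ?_
    set r : ℝ := k * t with hr
    have hr0 : 0 ≤ r := by positivity
    have hr1 : r + t ≤ h := by
      have : ((k + 1 : ℕ) : ℝ) ≤ N := by exact_mod_cast Finset.mem_range.1 hk
      rw [← hN, hr]
      push_cast at this
      nlinarith
    have hr' : ((k + 1 : ℕ) : ℝ) * t = r + t := by rw [hr]; push_cast; ring
    have hadd : x + r • e + t • e = x + (r + t) • e := by rw [add_assoc, add_smul]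
    have hU : ∀ r' ∈ Icc r (r + t), x + r' • e ∈ closure U := fun r' hr' => by
      have := hK _ hkK (r' - r) ⟨by linarith [hr'.1], by linarith [hr'.2]⟩
      rw [add_assoc, ← add_smul, add_sub_cancel] at this
      exact subset_closure this
    have hU0 := hU r ⟨le_rfl, by linarith⟩
    have hU1 := hU (r + t) ⟨by linarith, le_rfl⟩
    rw [hadd, ← hFf hU0, ← hFf hU1]
    have habs : |F (x + (r + t) • e) - F (x + r • e)| =
        ε * F (x + (r + t) • e) - ε * F (x + r • e) := by
      have hnn : 0 ≤ ε * F (x + (r + t) • e) - ε * F (x + r • e) :=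
        sub_nonneg.2 (hmono id monotone_id (by linarith : r ≤ r + t))
      rw [← abs_of_nonneg hnn, ← mul_sub, abs_mul]
      rcases Int.units_eq_one_or (s i) with hs | hs <;> simp [hε, hs]
    rw [habs]
    simp only [hD, hD', hr']
    have m1 := hγm (by linarith : r ≤ r + t)
    have m2 := hγm' (by linarith : r ≤ r + t)
    simp only at m1 m2
    have vlow : ∀ r' ∈ Icc r (r + t), x i + r' ≤ h * z i + h →
        γ (F (x + r' • e)) = F (x + r' • e) := fun r' hr' hb => by
      rw [hFf (hU r' hr')]
      exact hγf _ ⟨hlow r' (hr0.trans hr'.1) hb, hU r' hr'⟩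
    have vhigh : ∀ r' ∈ Icc r (r + t), h * z i + h ≤ x i + r' →
        γ' (F (x + r' • e)) = F (x + r' • e) := fun r' hr' hb => by
      rw [hFf (hU r' hr')]
      exact hγf' _ ⟨hhigh r' (hr'.2.trans hr1) hb, hU r' hr'⟩
    rcases le_total (x i + (r + t)) (h * z i + h) with hb | hb
    · rw [vlow r ⟨le_rfl, by linarith⟩ (by linarith), vlow (r + t) ⟨by linarith, le_rfl⟩ hb]
      linarith
    · rcases le_total (h * z i + h) (x i + r) with hb' | hb'
      · rw [vhigh r ⟨le_rfl, by linarith⟩ hb', vhigh (r + t) ⟨by linarith, le_rfl⟩ hb]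
        linarith
      · -- the step crosses the common face of the two cubes, at the point with parameter `q`
        set q : ℝ := h * z i + h - x i with hq
        have hq1 : r ≤ q := by linarith
        have hq2 : q ≤ r + t := by linarith
        have a1 := hγm' hq1
        have a2 := hγm hq2
        simp only at a1 a2
        rw [vlow q ⟨hq1, hq2⟩ (by linarith)] at a2
        rw [vhigh q ⟨hq1, hq2⟩ (by linarith)] at a1
        rw [vlow r ⟨le_rfl, by linarith⟩ hb', vhigh (r + t) ⟨by linarith, le_rfl⟩ hb]
        linarith
  refine (Finset.sum_le_sum hstep).trans ?_
  rw [← ENNReal.ofReal_sum_of_nonneg fun k _ => add_nonneg (hDm k) (hDm' k),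
    Finset.sum_add_distrib, Finset.sum_range_sub, Finset.sum_range_sub]
  exact ENNReal.ofReal_add_le.trans (add_le_add (hεosc γ _ hγo _ _) (hεosc γ' _ hγo' _ _))

lemma lintegral_MVar_add_neighbour (hd : 1 ≤ d) (f : Space d → ℝ) (U : Set (Space d)) {h : ℝ}
    (hh : 0 < h) (i : Fin d) :
    ∫⁻ y : Space d, (MVar f (gridCube h (cellIndex h y) ∩ closure U) +
        MVar f (gridCube h (cellIndex h y + Pi.single i 1) ∩ closure U)) =
      2 * gridMVarSum f U h * ENNReal.ofReal h := by
  set w : Fin d → ℤ := Pi.single i 1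
  obtain ⟨O, hO⟩ : ∃ O : (Fin d → ℤ) → ℝ≥0∞, ∀ z, MVar f (gridCube h z ∩ closure U) = O z :=
    ⟨_, fun _ => rfl⟩
  have h1 := gridMVarSum_mul_eq_lintegral hd f U hh
  simp only [hO] at h1 ⊢
  rw [mul_assoc, h1, lintegral_cellIndex hh O, lintegral_cellIndex hh fun z => O z + O (z + w)]
  simp only [add_mul]
  rw [ENNReal.tsum_add, two_mul]
  congr 1
  exact (Equiv.addRight w).tsum_eq (fun z => O z * ENNReal.ofReal h ^ d)

lemma mul_lintegral_increment_le (hd : 1 ≤ d) {s : SignVec d} {f : Space d → ℝ}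
    {U K : Set (Space d)} (hf : NondecreasingWrt s f (closure U)) (hc : ContinuousOn f (closure U))
    (hl : BddBelow (f '' closure U)) (hu : BddAbove (f '' closure U)) {h t : ℝ} (hh : 0 < h)
    (ht : 0 ≤ t) {N : ℕ} (hN : N * t = h) (i : Fin d) (hKm : MeasurableSet K)
    (hK : ∀ x ∈ K, ∀ r ∈ Icc 0 t, x + r • EuclideanSpace.single i (1 : ℝ) ∈ U) :
    N * ∫⁻ y, K.indicator (fun y => ‖f (y + t • EuclideanSpace.single i (1 : ℝ)) - f y‖ₑ) y ≤
      2 * gridMVarSum f U h * ENNReal.ofReal h := by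
  set e : Space d := EuclideanSpace.single i (1 : ℝ) with he
  set G := K.indicator (fun y => ‖f (y + t • e) - f y‖ₑ) with hG
  have hGm : AEMeasurable G := by
    rw [hG, aemeasurable_indicator_iff hKm]
    have h0 : MapsTo (fun y => y) K (closure U) := fun y hy => by
      simpa using subset_closure (hK y hy 0 ⟨le_rfl, ht⟩)
    have h1 : MapsTo (fun y => y + t • e) K (closure U) := fun y hy =>
      subset_closure (hK y hy t ⟨ht, le_rfl⟩)
    exact (ContinuousOn.aemeasurable ((hc.comp (by fun_prop) h1).sub (hc.comp (by fun_prop) h0))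
      hKm).enorm
  have htrans : ∀ v : Space d, ∫⁻ y, G (y + v) = ∫⁻ y, G y := fun v =>
    lintegral_add_right_eq_self G v
  calc N * ∫⁻ y, G y = ∑ k ∈ Finset.range N, ∫⁻ y, G (y + (k * t) • e) := by
        simp [htrans]
    _ = ∫⁻ y, ∑ k ∈ Finset.range N, G (y + (k * t) • e) := by
        rw [lintegral_finsetSum']
        exact fun k _ => hGm.comp_quasiMeasurePreserving
          (measurePreserving_add_right _ _).quasiMeasurePreserving
    _ ≤ ∫⁻ y, (MVar f (gridCube h (cellIndex h y) ∩ closure U) +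
          MVar f (gridCube h (cellIndex h y + Pi.single i 1) ∩ closure U)) :=
        lintegral_mono fun y => sum_increments_le hf hl hu hh ht hN i hK y
    _ = 2 * gridMVarSum f U h * ENNReal.ofReal h :=
        lintegral_MVar_add_neighbour hd f U hh i

lemma integrable_indicator_of_continuousOn_closure {f : Space d → ℝ} {U : Set (Space d)}
    (hUo : IsOpen U) (hUb : Bornology.IsBounded U) (hc : ContinuousOn f (closure U)) :
    Integrable (U.indicator f) :=
  (integrable_indicator_iff hUo.measurableSet).2
    ((hc.integrableOn_compact hUb.isCompact_closure).mono_set subset_closure)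

/-- The difference quotients of `ψ` in direction `-e_i`, with steps `h / N`, move onto `f`, where
the increments are controlled by the grid sum. -/
lemma ofReal_integral_partial_le (hd : 1 ≤ d) {s : SignVec d} {f ψ : Space d → ℝ}
    {U : Set (Space d)} (hUo : IsOpen U) (hUb : Bornology.IsBounded U)
    (hf : NondecreasingWrt s f (closure U)) (hc : ContinuousOn f (closure U)) {h : ℝ} (hh : 0 < h)
    (i : Fin d) (hψ : ContDiff ℝ 1 ψ) (hψc : HasCompactSupport ψ) (hψU : tsupport ψ ⊆ U)
    (hψ1 : ∀ x, ‖ψ x‖ ≤ 1) :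
    ENNReal.ofReal (∫ y, U.indicator f y * fderiv ℝ ψ y (EuclideanSpace.single i 1)) ≤
      2 * gridMVarSum f U h := by
  set e : Space d := EuclideanSpace.single i (1 : ℝ) with he
  have hen : ‖e‖ = 1 := by simp [he]
  set F := U.indicator f with hFdef
  have hFi : Integrable F := integrable_indicator_of_continuousOn_closure hUo hUb hc
  have hl := hUb.isCompact_closure.bddBelow_image hc
  have hu := hUb.isCompact_closure.bddAbove_image hc
  set g : ℝ → ℝ := fun τ => ∫ y, F y * ψ (y + τ • e) with hg
  have hder : HasDerivAt g (∫ y, F y * fderiv ℝ ψ y e) 0 := by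
    simpa using (hasDerivAt_integral_mul_translate hFi hψ hψc e 0).2
  obtain ⟨δ, hδ, hδU⟩ := IsCompact.exists_cthickening_subset_open hψc hUo hψU
  have htN : Tendsto (fun N : ℕ => -(h / N)) atTop (𝓝[≠] 0) := by
    refine tendsto_nhdsWithin_iff.2 ⟨?_, ?_⟩
    · simpa using (tendsto_const_div_atTop_nhds_zero_nat h).neg
    · filter_upwards [eventually_gt_atTop 0] with N hN
      have : (0 : ℝ) < N := by exact_mod_cast hN
      simp [hh.ne', this.ne']
  have hlim := ENNReal.tendsto_ofReal ((hasDerivAt_iff_tendsto_slope.1 hder).comp htN)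
  refine le_of_tendsto hlim ?_
  filter_upwards [eventually_gt_atTop 0,
    (tendsto_const_div_atTop_nhds_zero_nat h).eventually (gt_mem_nhds hδ)] with N hN hNδ
  have hN0 : (0 : ℝ) < N := by exact_mod_cast hN
  set t : ℝ := h / N with ht
  have ht0 : 0 < t := by positivity
  have hNt : N * t = h := by rw [ht]; field_simp
  have hK : ∀ x ∈ tsupport ψ, ∀ r ∈ Icc 0 t, x + r • e ∈ U := fun x hx r hr => by
    refine hδU (Metric.mem_cthickening_of_dist_le _ x _ _ hx ?_)
    rw [dist_self_add_left, norm_smul, hen, mul_one, Real.norm_of_nonneg hr.1]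
    exact hr.2.trans hNδ.le
  have hmain := mul_lintegral_increment_le hd hf hc hl hu hh ht0.le hNt i
    (isClosed_tsupport ψ).measurableSet hK
  have hint : ∀ v : Space d, Integrable fun y => F y * ψ (y + v) := fun v => by
    refine hFi.mul_bdd (c := 1) (Continuous.aestronglyMeasurable ?_)
      (Eventually.of_forall fun y => hψ1 _)
    exact hψ.continuous.comp (by fun_prop)
  have hshift : ∫ y, F y * ψ (y + (-t) • e) = ∫ y, F (y + t • e) * ψ y := by
    rw [← integral_add_right_eq_self _ (t • e)]
    simp [add_assoc]
  have hint' : Integrable fun y => F (y + t • e) * ψ y := by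
    have := (hint ((-t) • e)).comp_add_right (t • e)
    simpa [add_assoc] using this
  have hdiff : g 0 - g (-t) = ∫ y, ψ y * (F y - F (y + t • e)) := by
    have h0 : g 0 = ∫ y, F y * ψ y := by simp [hg]
    rw [h0]
    simp only [hg]
    rw [hshift, ← integral_sub (by simpa using hint 0) hint']
    exact integral_congr_ae (Eventually.of_forall fun y => by dsimp; ring)
  have hle : ENNReal.ofReal (g 0 - g (-t)) ≤
      ∫⁻ y, (tsupport ψ).indicator (fun y => ‖f (y + t • e) - f y‖ₑ) y := by
    rw [hdiff]
    refine (Real.ofReal_le_enorm _).trans ((enorm_integral_le_lintegral_enorm _).trans ?_)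
    refine lintegral_mono fun y => ?_
    by_cases hy : y ∈ tsupport ψ
    · have h0 : y ∈ U := hψU hy
      rw [indicator_of_mem hy, hFdef, indicator_of_mem h0,
        indicator_of_mem (hK y hy t ⟨ht0.le, le_rfl⟩), enorm_mul, enorm_sub_rev]
      refine mul_le_of_le_one_left bot_le ?_
      rw [← ofReal_norm]
      simpa using ENNReal.ofReal_le_ofReal (hψ1 y)
    · simp [image_eq_zero_of_notMem_tsupport hy]
  have hslope : slope g 0 (-t) = (N * (g 0 - g (-t))) / h := by
    rw [slope_def_field, ← hNt]
    field_simp [ht0.ne']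
    ring
  rw [Function.comp_apply, hslope, ENNReal.ofReal_div_of_pos hh]
  refine ENNReal.div_le_of_le_mul (le_trans ?_ hmain)
  rw [ENNReal.ofReal_mul hN0.le, ENNReal.ofReal_natCast]
  gcongr

lemma totalVar_le_gridMVarSum (hd : 1 ≤ d) {f : Space d → ℝ} {U : Set (Space d)} (hUo : IsOpen U)
    (hUb : Bornology.IsBounded U) (hf : IsMonotoneOn f (closure U))
    (hc : ContinuousOn f (closure U)) {h : ℝ} (hh : 0 < h) :
    totalVar f U ≤ (2 * d : ℝ≥0) * gridMVarSum f U h := by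
  obtain ⟨s, hs⟩ := hf
  refine iSup₂_le fun φ hφ => ?_
  obtain ⟨hφ1, hφc, hφU, hφb⟩ := hφ
  set F := U.indicator f with hFdef
  have hFi : Integrable F := integrable_indicator_of_continuousOn_closure hUo hUb hc
  have hcomp : ∀ i : Fin d, ContDiff ℝ 1 fun x => φ x i := fun i =>
    (EuclideanSpace.proj (𝕜 := ℝ) i).contDiff.comp hφ1
  have hsub : ∀ i : Fin d, Function.support (fun x => φ x i) ⊆ Function.support φ := by
    intro i x hx h0
    exact hx (by simp [h0])
  have hcs : ∀ i : Fin d, HasCompactSupport fun x => φ x i := fun i =>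
    hφc.mono (hsub i)
  have hfd : ∀ (i : Fin d) (x v : Space d), fderiv ℝ φ x v i = fderiv ℝ (fun x => φ x i) x v := by
    intro i x v
    have h1 := ((EuclideanSpace.proj (𝕜 := ℝ) i).hasFDerivAt (x := φ x)).comp x
      (hφ1.differentiable one_ne_zero x).hasFDerivAt
    have h2 : fderiv ℝ (fun x => φ x i) x = _ := h1.fderiv
    rw [h2]
    rfl
  have hI : ∀ i : Fin d, Integrable fun y =>
      F y * fderiv ℝ (fun x => φ x i) y (EuclideanSpace.single i 1) := fun i => by
    simpa using (hasDerivAt_integral_mul_translate hFi (hcomp i) (hcs i)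
      (EuclideanSpace.single i 1) 0).1
  have heq : ∫ x in U, f x * divergence φ x =
      ∑ i, ∫ y, F y * fderiv ℝ (fun x => φ x i) y (EuclideanSpace.single i 1) := by
    rw [← integral_finsetSum _ fun i _ => hI i, ← integral_indicator hUo.measurableSet]
    refine integral_congr_ae (Eventually.of_forall fun y => ?_)
    simp only [hFdef, divergence, hfd, ← Finset.mul_sum]
    by_cases hy : y ∈ U <;> simp [hy]
  rw [heq]
  calc ENNReal.ofReal (∑ i, ∫ y, F y * fderiv ℝ (fun x => φ x i) y (EuclideanSpace.single i 1))
      ≤ ∑ i, ENNReal.ofReal (∫ y, F y * fderiv ℝ (fun x => φ x i) y (EuclideanSpace.single i 1)) :=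
        Finset.le_sum_of_subadditive _ ENNReal.ofReal_zero.le (fun _ _ => ENNReal.ofReal_add_le) _ _
    _ ≤ ∑ _i : Fin d, 2 * gridMVarSum f U h := by
        refine Finset.sum_le_sum fun i _ => ofReal_integral_partial_le hd hUo hUb hs hc hh i (hcomp i)
          (hcs i) ((closure_mono (hsub i)).trans hφU) fun x => ?_
        exact (PiLp.norm_apply_le (φ x) i).trans (hφb x)
    _ = (2 * d : ℝ≥0) * gridMVarSum f U h := by
        simp
        ring

/-! ### The volume of neighbourhoods of a Lipschitz boundary -/

/-- The layer of half-width `a` around a Lipschitz graph has volume of order `a`: about `1 / a`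
translates of it in the direction `e` are disjoint and fit into a fixed ball. -/
lemma exists_volume_graph_layer_le {e : Space d} (he : ‖e‖ = 1) {g : (ℝ ∙ e)ᗮ → ℝ}
    (hg : Continuous g) (p : Space d) (r : ℝ) :
    ∃ C : ℝ≥0, ∀ a : ℝ, 0 < a → a ≤ 1 →
      volume {x | x ∈ Metric.ball p r ∧
        |⟪e, x⟫ - g ((ℝ ∙ e)ᗮ.orthogonalProjectionOnto x)| ≤ a} ≤ C * ENNReal.ofReal a := by
  set G : Space d → ℝ := fun x => ⟪e, x⟫ - g ((ℝ ∙ e)ᗮ.orthogonalProjectionOnto x) with hG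
  have hGc : Continuous G := by fun_prop
  have hGt : ∀ (x : Space d) (c : ℝ), G (x + c • e) = G x + c := by
    intro x c
    have h1 : (ℝ ∙ e)ᗮ.orthogonalProjectionOnto (c • e) = 0 := by
      rw [Submodule.orthogonalProjectionOnto_eq_zero_iff, Submodule.orthogonal_orthogonal]
      exact Submodule.smul_mem _ _ (Submodule.mem_span_singleton_self e)
    simp only [hG, map_add, h1, add_zero, inner_add_right, inner_smul_right,
      real_inner_self_eq_norm_sq, he]
    ring
  refine ⟨(volume (Metric.ball p (r + 3))).toNNReal, fun a ha ha1 => ?_⟩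
  rw [ENNReal.coe_toNNReal measure_ball_lt_top.ne]
  change volume {x | x ∈ Metric.ball p r ∧ |G x| ≤ a} ≤ _
  set S := {x | x ∈ Metric.ball p r ∧ |G x| ≤ a} with hS
  have hSm : MeasurableSet S :=
    Metric.isOpen_ball.measurableSet.inter (isClosed_le hGc.abs continuous_const).measurableSet
  set N := ⌈1 / a⌉₊ with hN
  set T : ℕ → Set (Space d) := fun k => (fun x => x + (3 * a * k) • e) ⁻¹' S with hT
  have hTm : ∀ k, MeasurableSet (T k) := fun k => (by fun_prop : Measurable _) hSm
  have hTv : ∀ k, volume (T k) = volume S := fun k => measure_preimage_add_right _ _ _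
  have hdisj : Pairwise (Function.onFun Disjoint T) := by
    intro k l hkl
    refine disjoint_left.2 fun x hk hl => hkl ?_
    have h1 := abs_le.1 hk.2
    have h2 := abs_le.1 hl.2
    rw [hGt] at h1 h2
    by_contra hne
    rcases lt_or_gt_of_ne hne with hlt | hlt
    · have : (k : ℝ) + 1 ≤ l := by exact_mod_cast hlt
      nlinarith
    · have : (l : ℝ) + 1 ≤ k := by exact_mod_cast hlt
      nlinarith
  have hsub : (⋃ k ∈ Finset.range N, T k) ⊆ Metric.ball p (r + 3) := by
    refine iUnion₂_subset fun k hk x hx => ?_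
    have hk1 : (k : ℝ) < 1 / a := Nat.lt_ceil.1 (Finset.mem_range.1 hk)
    have hk3 : 3 * a * k ≤ 3 := by
      rw [lt_div_iff₀ ha] at hk1
      linarith
    have h1 : dist x (x + (3 * a * k) • e) ≤ 3 := by
      rw [dist_self_add_right, norm_smul, he, mul_one, Real.norm_of_nonneg (by positivity)]
      exact hk3
    have h2 : dist (x + (3 * a * k) • e) p < r := hx.1
    exact Metric.mem_ball.2 ((dist_triangle _ _ _).trans_lt (by linarith))
  have hvol : N * volume S ≤ volume (Metric.ball p (r + 3)) := by
    refine le_trans (le_of_eq ?_) (measure_mono hsub)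
    rw [measure_biUnion_finset (fun k _ l _ hkl => hdisj hkl) fun k _ => hTm k]
    simp [hTv]
  have hNa : 1 ≤ ENNReal.ofReal a * N := by
    rw [← ENNReal.ofReal_natCast, ← ENNReal.ofReal_mul ha.le, ENNReal.one_le_ofReal]
    have := Nat.le_ceil (1 / a)
    rw [div_le_iff₀ ha] at this
    linarith
  calc volume S ≤ (ENNReal.ofReal a * N) * volume S := le_mul_of_one_le_left bot_le hNa
    _ = ENNReal.ofReal a * (N * volume S) := mul_assoc _ _ _
    _ ≤ ENNReal.ofReal a * volume (Metric.ball p (r + 3)) := by gcongr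
    _ = _ := mul_comm _ _

/-- The boundary of a bounded Lipschitz domain has finite upper Minkowski content. -/
lemma IsLipschitzDomain.exists_volume_thickening_frontier_le {U : Set (Space d)}
    (hU : IsLipschitzDomain U) (hUb : Bornology.IsBounded U) :
    ∃ C : ℝ≥0, ∃ ρ₀ : ℝ, 0 < ρ₀ ∧ ∀ ρ : ℝ, 0 < ρ → ρ ≤ ρ₀ →
      volume (Metric.thickening ρ (frontier U)) ≤ C * ENNReal.ofReal ρ := by
  have hcomp : IsCompact (frontier U) :=
    hUb.isCompact_closure.of_isClosed_subset isClosed_frontier frontier_subset_closure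
  refine hcomp.induction_on (p := fun s => ∃ C : ℝ≥0, ∃ ρ₀ : ℝ, 0 < ρ₀ ∧ ∀ ρ : ℝ, 0 < ρ → ρ ≤ ρ₀ →
      volume (Metric.thickening ρ s) ≤ C * ENNReal.ofReal ρ) ?_ ?_ ?_ ?_
  · exact ⟨0, 1, one_pos, by simp⟩
  · rintro s t hst ⟨C, ρ₀, hρ₀, h⟩
    exact ⟨C, ρ₀, hρ₀, fun ρ h0 h1 =>
      (measure_mono (Metric.thickening_subset_of_subset ρ hst)).trans (h ρ h0 h1)⟩
  · rintro s t ⟨C, ρ₀, hρ₀, h⟩ ⟨C', ρ₀', hρ₀', h'⟩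
    refine ⟨C + C', min ρ₀ ρ₀', lt_min hρ₀ hρ₀', fun ρ h0 h1 => ?_⟩
    rw [Metric.thickening_union, ENNReal.coe_add, add_mul]
    exact (measure_union_le _ _).trans
      (add_le_add (h ρ h0 (h1.trans (min_le_left _ _))) (h' ρ h0 (h1.trans (min_le_right _ _))))
  · intro p hp
    obtain ⟨e, he, r, hr, K, g, hg, hUg⟩ := hU.2 p hp
    obtain ⟨C, hC⟩ := exists_volume_graph_layer_le he hg.continuous p r
    set G : Space d → ℝ := fun x => ⟪e, x⟫ - g ((ℝ ∙ e)ᗮ.orthogonalProjectionOnto x) with hG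
    have hGc : Continuous G := by
      have := hg.continuous
      fun_prop
    have hGlip : ∀ x y, |G x - G y| ≤ (1 + K) * dist x y := by
      intro x y
      have h1 : |⟪e, x⟫ - ⟪e, y⟫| ≤ dist x y := by
        rw [← inner_sub_right, dist_eq_norm]
        simpa [he] using abs_real_inner_le_norm e (x - y)
      have h2 : |g ((ℝ ∙ e)ᗮ.orthogonalProjectionOnto x) -
          g ((ℝ ∙ e)ᗮ.orthogonalProjectionOnto y)| ≤ K * dist x y := by
        rw [← Real.dist_eq]
        refine (hg.dist_le_mul _ _).trans ?_
        gcongr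
        rw [dist_eq_norm, dist_eq_norm, ← map_sub]
        exact Submodule.norm_orthogonalProjectionOnto_apply_le _ _
      have h3 : G x - G y = (⟪e, x⟫ - ⟪e, y⟫) -
        (g ((ℝ ∙ e)ᗮ.orthogonalProjectionOnto x) -
          g ((ℝ ∙ e)ᗮ.orthogonalProjectionOnto y)) := by
        simp only [hG]
        ring
      rw [h3]
      refine (abs_sub _ _).trans ?_
      linarith
    -- near `p` the boundary lies on the graph
    have hzero : ∀ q ∈ frontier U, q ∈ Metric.ball p r → G q = 0 := by
      intro q hq hqb
      have hqU : q ∉ U := by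
        rw [hU.1.frontier_eq] at hq
        exact hq.2
      have h0 : 0 ≤ G q := by
        by_contra hlt
        exact hqU ((hUg q hqb).2 (by simp only [hG] at hlt; linarith))
      refine le_antisymm (not_lt.1 fun hpos => ?_) h0
      have hopen : IsOpen (Metric.ball p r ∩ G ⁻¹' Ioi 0) :=
        Metric.isOpen_ball.inter (isOpen_Ioi.preimage hGc)
      obtain ⟨y, hy, hyU⟩ := mem_closure_iff.1 (frontier_subset_closure hq) _ hopen ⟨hqb, hpos⟩
      have h1 := (hUg y hy.1).1 hyU
      have h2 : 0 < G y := hy.2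
      simp only [hG] at h2
      linarith
    refine ⟨frontier U ∩ Metric.ball p (r / 2), inter_mem_nhdsWithin _
      (Metric.ball_mem_nhds p (by linarith)), C * (1 + K), min (r / 2) (1 / (1 + K)), by positivity,
      fun ρ h0 h1 => ?_⟩
    have hK : (0 : ℝ) < 1 + K := by positivity
    have hρ1 : (1 + K) * ρ ≤ 1 := by
      have := h1.trans (min_le_right _ _)
      rw [le_div_iff₀ hK] at this
      linarith
    have hsub : Metric.thickening ρ (frontier U ∩ Metric.ball p (r / 2)) ⊆
        {x | x ∈ Metric.ball p r ∧ |G x| ≤ (1 + K) * ρ} := by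
      intro x hx
      obtain ⟨q, ⟨hqU, hqb⟩, hxq⟩ := Metric.mem_thickening_iff.1 hx
      refine ⟨?_, ?_⟩
      · refine Metric.mem_ball.2 ((dist_triangle x q p).trans_lt ?_)
        have := Metric.mem_ball.1 hqb
        have := h1.trans (min_le_left _ _)
        linarith
      · have h2 := hGlip x q
        rw [hzero q hqU (Metric.ball_subset_ball (by linarith) hqb), sub_zero] at h2
        exact h2.trans (by gcongr)
    refine (measure_mono hsub).trans ((hC _ (by positivity) hρ1).trans (le_of_eq ?_))
    rw [ENNReal.ofReal_mul hK.le, ENNReal.coe_mul, mul_assoc]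
    congr 2
    rw [← ENNReal.ofReal_coe_nnreal, NNReal.coe_add, NNReal.coe_one]

/-! ### Increments in the interior are bounded by the total variation -/

lemma divergence_smul_const {ψ : Space d → ℝ} {y : Space d} (hψ : DifferentiableAt ℝ ψ y)
    (u : Space d) : divergence (fun y => ψ y • u) y = fderiv ℝ ψ y u := by
  have h1 : fderiv ℝ (fun y => ψ y • u) y = (fderiv ℝ ψ y).smulRight u :=
    (hψ.hasFDerivAt.smul_const u).fderiv
  have h2 : u = ∑ i, u i • EuclideanSpace.single i (1 : ℝ) := by
    ext j
    simp [Pi.single_apply]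
  unfold divergence
  rw [h1]
  conv_rhs => rw [h2, map_sum]
  refine Finset.sum_congr rfl fun i _ => ?_
  simp [mul_comm]

/-- Testing the total variation with the translates of a cutoff function `η` times `v`: the
integral `∫ f (y) η (y + τ v) dy` has a derivative in `τ` of size at most `‖v‖ Var(f; U)`. -/
lemma lintegral_increment_le_totalVar {f : Space d → ℝ} {U : Set (Space d)} (hUo : IsOpen U)
    (hUb : Bornology.IsBounded U) (hc : ContinuousOn f (closure U)) (hTV : totalVar f U ≠ ∞)
    {v : Space d} {ρ : ℝ} (hv : ‖v‖ < ρ)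
    (hf : ∀ x, x + v ∈ U → x - v ∈ U → f (x - v) ≤ f (x + v)) :
    ∫⁻ x, {x | Metric.closedBall x ρ ⊆ U}.indicator
        (fun x => ENNReal.ofReal (f (x + v) - f (x - v))) x ≤
      ENNReal.ofReal (2 * ‖v‖) * totalVar f U := by
  set V := {x : Space d | Metric.closedBall x ρ ⊆ U} with hV
  set F := U.indicator f with hFdef
  have hFi : Integrable F := integrable_indicator_of_continuousOn_closure hUo hUb hc
  -- a cutoff equal to `1` on `V`; its support, moved by up to `v` either way, stays inside `U`
  set δ := (ρ - ‖v‖) / 2 with hδ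
  have hδ0 : 0 < δ := by rw [hδ]; linarith
  have hρ : 0 < ρ := (norm_nonneg v).trans_lt hv
  have hVU : V ⊆ U := fun x hx => hx (Metric.mem_closedBall_self hρ.le)
  obtain ⟨η, hη1, hη0, hη⟩ := exists_contMDiffMap_one_nhds_of_subset_interior
    (modelWithCornersSelf ℝ (Space d)) (n := 1) (isClosed_closure (s := V))
    ((Metric.closure_subset_thickening hδ0 V).trans (Metric.thickening_subset_interior_cthickening _ _))
  have hηd : ContDiff ℝ 1 η := η.contMDiff.contDiff
  have hηs : tsupport η ⊆ Metric.cthickening δ V :=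
    closure_minimal (fun x hx => by_contra fun hn => hx (hη0 x hn)) Metric.isClosed_cthickening
  have hηc : HasCompactSupport η :=
    ((hUb.subset hVU).cthickening).isCompact_closure.of_isClosed_subset (isClosed_tsupport _)
      (hηs.trans subset_closure)
  have hηU : ∀ x ∈ tsupport η, ∀ r : ℝ, |r| ≤ 1 → x + r • v ∈ U := by
    intro x hx r hr
    have h1 := Metric.cthickening_subset_thickening' (δ₂ := ρ - ‖v‖) (by linarith)
      (by rw [hδ]; linarith) V (hηs hx)
    obtain ⟨q, hqV, hq⟩ := Metric.mem_thickening_iff.1 h1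
    refine hqV (Metric.mem_closedBall.2 ?_)
    have h2 : dist (x + r • v) x ≤ ‖v‖ := by
      rw [dist_self_add_left, norm_smul]
      exact mul_le_of_le_one_left (norm_nonneg _) hr
    linarith [dist_triangle (x + r • v) x q]
  set g : ℝ → ℝ := fun τ => ∫ y, F y * η (y + τ • v) with hg
  have hgd : ∀ τ, HasDerivAt g (∫ y, F y * fderiv ℝ η (y + τ • v) v) τ := fun τ =>
    (hasDerivAt_integral_mul_translate hFi hηd hηc v τ).2
  have hder : ∀ τ ∈ Icc (-1 : ℝ) 1, -(∫ y, F y * fderiv ℝ η (y + τ • v) v) ≤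
      ‖v‖ * (totalVar f U).toReal := by
    intro τ hτ
    set u : Space d := -(‖v‖⁻¹ • v) with hu
    have hvu : v = -(‖v‖ • u) := by
      rcases eq_or_ne v 0 with rfl | hv0
      · simp
      · rw [hu, smul_neg, neg_neg, smul_inv_smul₀ (norm_ne_zero_iff.2 hv0)]
    have hun : ‖u‖ ≤ 1 := by
      rw [hu, norm_neg, norm_smul, norm_inv, norm_norm]
      exact inv_mul_le_one
    set ψ : Space d → ℝ := fun y => η (y + τ • v) with hψ
    have hψd : ContDiff ℝ 1 ψ := hηd.comp (by fun_prop)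
    have hψf : ∀ y, fderiv ℝ ψ y = fderiv ℝ η (y + τ • v) := fun y =>
      fderiv_comp_add_right (f := η) (τ • v)
    have hψc : HasCompactSupport ψ := hηc.comp_homeomorph (Homeomorph.addRight (τ • v))
    have hφs : tsupport (fun y => ψ y • u) ⊆ tsupport ψ := tsupport_smul_subset_left ψ _
    have hψU : tsupport ψ ⊆ U := by
      intro y hy
      have h1 : y + τ • v ∈ tsupport η :=
        tsupport_comp_subset_preimage η (by fun_prop : Continuous fun y : Space d => y + τ • v) hy
      have h2 := hηU _ h1 (-τ) (by rw [abs_neg]; exact abs_le.2 hτ)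
      simpa using h2
    have hadm : ENNReal.ofReal (∫ x in U, f x * divergence (fun y => ψ y • u) x) ≤
        totalVar f U := by
      refine le_iSup₂_of_le (fun y => ψ y • u) ⟨hψd.smul contDiff_const, ?_, hφs.trans hψU, ?_⟩
        le_rfl
      · exact hψc.smul_right
      · intro x
        rw [norm_smul]
        refine mul_le_one₀ ?_ (norm_nonneg _) hun
        rw [Real.norm_eq_abs, abs_of_nonneg (hη _).1]
        exact (hη _).2
    have h1 : ∫ x in U, f x * divergence (fun y => ψ y • u) x =
        ∫ y, F y * fderiv ℝ η (y + τ • v) u := by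
      rw [← integral_indicator hUo.measurableSet]
      refine integral_congr_ae (Eventually.of_forall fun y => ?_)
      simp only [divergence_smul_const (hψd.differentiable one_ne_zero _), hψf, hFdef]
      by_cases hy : y ∈ U <;> simp [hy]
    have h2 : -(∫ y, F y * fderiv ℝ η (y + τ • v) v) =
        ‖v‖ * ∫ y, F y * fderiv ℝ η (y + τ • v) u := by
      rw [← integral_neg, ← integral_const_mul]
      refine integral_congr_ae (Eventually.of_forall fun y => ?_)
      have h3 : fderiv ℝ η (y + τ • v) v = -(‖v‖ * fderiv ℝ η (y + τ • v) u) := by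
        have h4 := congrArg (fderiv ℝ η (y + τ • v)) hvu
        rwa [map_neg, map_smul, smul_eq_mul] at h4
      dsimp only
      rw [h3]
      ring
    rw [h2, ← h1]
    gcongr
    exact (ENNReal.ofReal_le_iff_le_toReal hTV).1 hadm
  have hgle : g (-1) - g 1 ≤ 2 * ‖v‖ * (totalVar f U).toReal := by
    have := Convex.image_sub_le_mul_sub_of_deriv_le (f := fun τ => -g τ) (convex_Icc (-1 : ℝ) 1)
      (fun τ _ => (hgd τ).neg.continuousAt.continuousWithinAt)
      (fun τ _ => (hgd τ).neg.differentiableAt.differentiableWithinAt)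
      (C := ‖v‖ * (totalVar f U).toReal)
      (fun τ hτ => by
        have h1 : deriv (fun τ => -g τ) τ = _ := (hgd τ).neg.deriv
        rw [h1]
        exact hder τ (interior_subset hτ))
      (-1) (by simp) 1 (by simp) (by norm_num)
    linarith
  have hint : ∀ w : Space d, Integrable fun y => F (y + w) * η y := fun w =>
    (hFi.comp_add_right w).mul_bdd (c := 1) hηd.continuous.aestronglyMeasurable
      (Eventually.of_forall fun y => by
        rw [Real.norm_eq_abs, abs_of_nonneg (hη y).1]
        exact (hη y).2)
  have hshift : ∀ τ : ℝ, g τ = ∫ y, F (y + -(τ • v)) * η y := fun τ => by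
    rw [← integral_add_right_eq_self (fun y => F (y + -(τ • v)) * η y) (τ • v)]
    simp [hg]
  have hdiff : g (-1) - g 1 = ∫ y, (F (y + v) - F (y - v)) * η y := by
    rw [hshift, hshift, ← integral_sub (hint _) (hint _)]
    refine integral_congr_ae (Eventually.of_forall fun y => ?_)
    simp [sub_mul, ← sub_eq_add_neg]
  have hvals : ∀ y ∈ tsupport η, y + v ∈ U ∧ y - v ∈ U := fun y hy =>
    ⟨by simpa using hηU y hy 1 (by simp), by
      simpa [← sub_eq_add_neg] using hηU y hy (-1) (by simp)⟩
  have hnonneg : ∀ y, 0 ≤ (F (y + v) - F (y - v)) * η y := by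
    intro y
    by_cases hy : y ∈ tsupport η
    · obtain ⟨h1, h2⟩ := hvals y hy
      rw [hFdef, indicator_of_mem h1, indicator_of_mem h2]
      exact mul_nonneg (sub_nonneg.2 (hf y h1 h2)) (hη y).1
    · simp [image_eq_zero_of_notMem_tsupport hy]
  have hint2 : Integrable fun y => (F (y + v) - F (y - v)) * η y := by
    refine ((hint v).sub (hint (-v))).congr (Eventually.of_forall fun y => ?_)
    simp [sub_mul, ← sub_eq_add_neg]
  calc ∫⁻ x, V.indicator (fun x => ENNReal.ofReal (f (x + v) - f (x - v))) x
      ≤ ∫⁻ y, ENNReal.ofReal ((F (y + v) - F (y - v)) * η y) := by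
        refine lintegral_mono fun y => ?_
        by_cases hy : y ∈ V
        · have h1 : η y = 1 := hη1.self_of_nhdsSet y (subset_closure hy)
          obtain ⟨h2, h3⟩ := hvals y (subset_tsupport _ (by simp [h1]))
          rw [indicator_of_mem hy, hFdef, indicator_of_mem h2, indicator_of_mem h3, h1, mul_one]
        · simp [indicator_of_notMem hy]
    _ = ENNReal.ofReal (g (-1) - g 1) := by
        rw [hdiff, ofReal_integral_eq_lintegral_ofReal hint2 (Eventually.of_forall hnonneg)]
    _ ≤ ENNReal.ofReal (2 * ‖v‖ * (totalVar f U).toReal) := ENNReal.ofReal_le_ofReal hgle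
    _ = ENNReal.ofReal (2 * ‖v‖) * totalVar f U := by
        rw [ENNReal.ofReal_mul (by positivity), ENNReal.ofReal_toReal hTV]

/-! ### The grid sums are asymptotically bounded by the total variation -/

/-- The vector `h s`; adding it to a point of a grid cube of side `h` gives a point above the whole
cube in the order of `s`. -/
def diagonalVec (s : SignVec d) (h : ℝ) : Space d :=
  WithLp.toLp 2 fun i => ((s i : ℤ) : ℝ) * h

lemma norm_diagonalVec (s : SignVec d) {h : ℝ} (hh : 0 ≤ h) : ‖diagonalVec s h‖ = √d * h := by
  rw [EuclideanSpace.norm_eq, ← Real.sqrt_sq hh, ← Real.sqrt_mul (Nat.cast_nonneg d)]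
  congr 1
  have : ∀ i, ‖diagonalVec s h i‖ ^ 2 = h ^ 2 := fun i => by
    rw [Real.norm_eq_abs, sq_abs, diagonalVec, mul_pow, sq ((s i : ℤ) : ℝ), sign_mul_self, one_mul]
  rw [Real.sqrt_sq hh, Finset.sum_congr rfl fun i _ => this i]
  simp

lemma signMul_le_signMul_add_diagonalVec (s : SignVec d) {h : ℝ} {x y : Space d} {i : Fin d}
    (hxy : |y i - x i| ≤ h) : signMul s y i ≤ signMul s (x + diagonalVec s h) i := by
  rw [signMul_apply, signMul_apply, PiLp.add_apply, diagonalVec, mul_add, ← mul_assoc,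
    sign_mul_self, one_mul]
  obtain ⟨h1, h2⟩ := abs_le.1 hxy
  rcases Int.units_eq_one_or (s i) with hs | hs <;> simp [hs] <;> linarith

lemma signMul_sub_diagonalVec_le_signMul (s : SignVec d) {h : ℝ} {x y : Space d} {i : Fin d}
    (hxy : |y i - x i| ≤ h) : signMul s (x - diagonalVec s h) i ≤ signMul s y i := by
  rw [signMul_apply, signMul_apply, PiLp.sub_apply, diagonalVec, mul_sub, ← mul_assoc,
    sign_mul_self, one_mul]
  obtain ⟨h1, h2⟩ := abs_le.1 hxy
  rcases Int.units_eq_one_or (s i) with hs | hs <;> simp [hs] <;> linarith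

lemma exists_mem_segment_frontier {U : Set (Space d)} (hUo : IsOpen U) {a y : Space d}
    (ha : a ∈ closure U) (hy : y ∉ U) : ∃ p ∈ segment ℝ a y, p ∈ frontier U := by
  by_contra! hno
  have hsplit : ∀ p ∈ segment ℝ a y, p ∈ U ∨ p ∈ (closure U)ᶜ := fun p hp => by
    have := hno p hp
    rw [hUo.frontier_eq] at this
    by_cases hpU : p ∈ U
    · exact Or.inl hpU
    · exact Or.inr fun hpc => this ⟨hpc, hpU⟩
  have hseg : IsPreconnected (segment ℝ a y) := (convex_segment a y).isPreconnected
  obtain ⟨p, -, hpU, hpc⟩ := hseg U (closure U)ᶜ hUo isClosed_closure.isOpen_compl hsplit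
    ⟨a, left_mem_segment ℝ a y, (hsplit a (left_mem_segment ℝ a y)).resolve_right fun h => h ha⟩
    ⟨y, right_mem_segment ℝ a y, (hsplit y (right_mem_segment ℝ a y)).resolve_left hy⟩
  exact hpc (subset_closure hpU)

/-- A cube around a point far from the complement of `U` has M-variation at most the increment of
`f` along a diagonal; all other cubes that meet the closure of `U` lie near its boundary, and
there the modulus of continuity bounds the M-variation. -/
lemma MVar_cellIndex_le {s : SignVec d} {f : Space d → ℝ} {U : Set (Space d)}
    (hUo : IsOpen U) (hf : NondecreasingWrt s f (closure U)) {h R ε : ℝ} (hh : 0 < h) (hR : R = √d * h)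
    (hR0 : 0 < R)
    (hε : ∀ x ∈ closure U, ∀ y ∈ closure U, dist x y ≤ R → f x - f y ≤ ε) (x : Space d) :
    MVar f (gridCube h (cellIndex h x) ∩ closure U) ≤
      {x | Metric.closedBall x (2 * R) ⊆ U}.indicator
        (fun x => ENNReal.ofReal (f (x + diagonalVec s h) - f (x - diagonalVec s h))) x +
      (Metric.thickening (3 * R) (frontier U)).indicator (fun _ => ENNReal.ofReal ε) x := by
  set z := cellIndex h x with hz
  have hx : x ∈ gridCube h z := mem_gridCube_cellIndex hh x
  have hfA : NondecreasingWrt s f (gridCube h z ∩ closure U) := fun a ha b hb =>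
    hf a ha.2 b hb.2
  rcases (gridCube h z ∩ closure U).eq_empty_or_nonempty with he | ⟨a, haz, haU⟩
  · simp [he, MVar_empty]
  by_cases hxV : Metric.closedBall x (2 * R) ⊆ U
  · refine le_add_right ?_
    rw [indicator_of_mem (show x ∈ {x | Metric.closedBall x (2 * R) ⊆ U} from hxV)]
    have hnorm : ‖diagonalVec s h‖ = R := by rw [norm_diagonalVec s hh.le, hR]
    have hplus : x + diagonalVec s h ∈ closure U := subset_closure (hxV (by
      rw [Metric.mem_closedBall, dist_self_add_left, hnorm]
      linarith))
    have hminus : x - diagonalVec s h ∈ closure U := subset_closure (hxV (by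
      rw [Metric.mem_closedBall, sub_eq_add_neg, dist_self_add_left, norm_neg, hnorm]
      linarith))
    have hcoord : ∀ b ∈ gridCube h z, ∀ i, |b i - x i| ≤ h := fun b hb i => by
      have := hb i
      have := hx i
      exact abs_le.2 ⟨by linarith, by linarith⟩
    refine hfA.MVar_le_ofReal fun b hb c hc => sub_le_sub ?_ ?_
    · exact hf _ hb.2 _ hplus fun i => signMul_le_signMul_add_diagonalVec s (hcoord b hb.1 i)
    · exact hf _ hminus _ hc.2 fun i => signMul_sub_diagonalVec_le_signMul s (hcoord c hc.1 i)
  · refine le_add_left ?_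
    obtain ⟨y, hyx, hyU⟩ := not_subset.1 hxV
    have hax : a ∈ Metric.closedBall x (2 * R) := by
      have := dist_le_of_mem_gridCube hh haz hx
      rw [Metric.mem_closedBall]
      linarith
    obtain ⟨p, hp, hpU⟩ := exists_mem_segment_frontier hUo haU hyU
    have hpx := (convex_closedBall x (2 * R)).segment_subset hax hyx hp
    have hxT : x ∈ Metric.thickening (3 * R) (frontier U) := by
      refine Metric.mem_thickening_iff.2 ⟨p, hpU, ?_⟩
      rw [dist_comm]
      exact (Metric.mem_closedBall.1 hpx).trans_lt (by linarith)
    rw [indicator_of_mem hxT]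
    refine hfA.MVar_le_ofReal fun b hb c hc => hε b hb.2 c hc.2 ?_
    rw [hR]
    exact dist_le_of_mem_gridCube hh hb.1 hc.1

lemma gridMVarSum_le {s : SignVec d} (hd : 1 ≤ d) {f : Space d → ℝ} {U : Set (Space d)}
    (hUo : IsOpen U) (hUb : Bornology.IsBounded U) (hf : NondecreasingWrt s f (closure U))
    (hc : ContinuousOn f (closure U)) (hTV : totalVar f U ≠ ∞) {h ε : ℝ} {C : ℝ≥0} (hh : 0 < h)
    (hε : ∀ x ∈ closure U, ∀ y ∈ closure U, dist x y ≤ √d * h → f x - f y ≤ ε)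
    (hC : volume (Metric.thickening (3 * (√d * h)) (frontier U)) ≤
      C * ENNReal.ofReal (3 * (√d * h))) :
    gridMVarSum f U h ≤
      2 * ENNReal.ofReal √d * totalVar f U + 3 * ENNReal.ofReal √d * C * ENNReal.ofReal ε := by
  have hd0 : (0 : ℝ) < √d := Real.sqrt_pos.2 (by exact_mod_cast hd)
  have hR0 : 0 < √d * h := by positivity
  have hnorm := norm_diagonalVec s hh.le
  have hinc : ∀ x, x + diagonalVec s h ∈ U → x - diagonalVec s h ∈ U →
      f (x - diagonalVec s h) ≤ f (x + diagonalVec s h) := fun x h1 h2 =>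
    hf _ (subset_closure h2) _ (subset_closure h1) fun i =>
      (signMul_sub_diagonalVec_le_signMul s (y := x) (by simpa using hh.le)).trans
        (signMul_le_signMul_add_diagonalVec s (by simpa using hh.le))
  have hV := lintegral_increment_le_totalVar hUo hUb hc hTV (v := diagonalVec s h)
    (ρ := 2 * (√d * h)) (by rw [hnorm]; linarith) hinc
  refine (ENNReal.mul_le_mul_iff_left (c := ENNReal.ofReal h) (by simpa using hh)
    ENNReal.ofReal_ne_top).1 ?_
  calc gridMVarSum f U h * ENNReal.ofReal h
      = ∫⁻ x : Space d, MVar f (gridCube h (cellIndex h x) ∩ closure U) :=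
        gridMVarSum_mul_eq_lintegral hd f U hh
    _ ≤ ∫⁻ x, ({x | Metric.closedBall x (2 * (√d * h)) ⊆ U}.indicator
          (fun x => ENNReal.ofReal (f (x + diagonalVec s h) - f (x - diagonalVec s h))) x +
        (Metric.thickening (3 * (√d * h)) (frontier U)).indicator
          (fun _ => ENNReal.ofReal ε) x) :=
        lintegral_mono fun x => MVar_cellIndex_le hUo hf hh rfl hR0 hε x
    _ ≤ ENNReal.ofReal (2 * (√d * h)) * totalVar f U +
          ENNReal.ofReal ε * (C * ENNReal.ofReal (3 * (√d * h))) := by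
        have hTm := (Metric.isOpen_thickening (δ := 3 * (√d * h)) (E := frontier U)).measurableSet
        rw [lintegral_add_right _ (measurable_const.indicator hTm), lintegral_indicator_const hTm]
        rw [hnorm] at hV
        gcongr
    _ = (2 * ENNReal.ofReal √d * totalVar f U +
          3 * ENNReal.ofReal √d * C * ENNReal.ofReal ε) * ENNReal.ofReal h := by
        rw [ENNReal.ofReal_mul zero_le_two, ENNReal.ofReal_mul (by norm_num : (0 : ℝ) ≤ 3),
          ENNReal.ofReal_mul hd0.le, ENNReal.ofReal_ofNat, ENNReal.ofReal_ofNat]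
        ring

lemma limsup_gridMVarSum_le (hd : 1 ≤ d) {f : Space d → ℝ} {U : Set (Space d)}
    (hU : IsLipschitzDomain U) (hUb : Bornology.IsBounded U) (hf : IsMonotoneOn f (closure U))
    (hc : ContinuousOn f (closure U)) :
    limsup (fun h : ℝ => (((2 * d : ℝ≥0)⁻¹ : ℝ≥0) : ℝ≥0∞) * gridMVarSum f U h) (𝓝[>] 0) ≤
      totalVar f U := by
  obtain ⟨s, hs⟩ := hf
  obtain ⟨C, ρ₀, hρ₀, hC⟩ := hU.exists_volume_thickening_frontier_le hUb
  refine ENNReal.le_of_forall_pos_le_add fun ε' hε' hTV => limsup_le_of_le (by isBoundedDefault) ?_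
  set ε : ℝ≥0 := ε' / (2 * C + 1) with hεdef
  have hε0 : (0 : ℝ) < ε := by
    rw [NNReal.coe_pos, hεdef]
    positivity
  have huc := hUb.isCompact_closure.uniformContinuousOn_of_continuous hc
  obtain ⟨δ, hδ, hδf⟩ := Metric.uniformContinuousOn_iff.1 huc ε hε0
  have hd0 : (0 : ℝ) < √d := Real.sqrt_pos.2 (by exact_mod_cast hd)
  have hsmall : ∀ η : ℝ, 0 < η → ∀ᶠ h in 𝓝[>] (0 : ℝ), 3 * (√d * h) < η := fun η hη => by
    have : Tendsto (fun h : ℝ => 3 * (√d * h)) (𝓝 0) (𝓝 0) := by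
      have h1 : Continuous fun h : ℝ => 3 * (√d * h) := by fun_prop
      simpa using h1.tendsto 0
    exact (this.mono_left nhdsWithin_le_nhds).eventually (gt_mem_nhds hη)
  filter_upwards [self_mem_nhdsWithin, hsmall δ hδ, hsmall ρ₀ hρ₀] with h hh h1 h2
  have hh' : 0 < h := hh
  have hR0 : 0 < √d * h := by positivity
  have key := gridMVarSum_le hd hU.1 hUb hs hc hTV.ne hh' (ε := ε)
    (fun x hx y hy hxy => (le_abs_self _).trans
      (hδf x hx y hy (by linarith)).le) (hC _ (by linarith) h2.le)
  have hsd : ENNReal.ofReal √d ≤ d := by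
    rw [← ENNReal.ofReal_natCast]
    refine ENNReal.ofReal_le_ofReal (Real.sqrt_le_iff.2 ⟨Nat.cast_nonneg d, ?_⟩)
    have : (1 : ℝ) ≤ d := by exact_mod_cast hd
    nlinarith
  have hcε : 2 * (C : ℝ≥0∞) * ε ≤ ε' := by
    rw [hεdef]
    have h3 : 2 * C * (ε' / (2 * C + 1)) ≤ ε' := by
      rw [mul_div_assoc', div_le_iff₀ (by positivity)]
      nlinarith [hε'.le]
    exact_mod_cast h3
  have hdd : (2 * d : ℝ≥0) ≠ 0 := by
    have : (d : ℝ≥0) ≠ 0 := by exact_mod_cast (by omega : d ≠ 0)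
    positivity
  calc (((2 * d : ℝ≥0)⁻¹ : ℝ≥0) : ℝ≥0∞) * gridMVarSum f U h
      ≤ (((2 * d : ℝ≥0)⁻¹ : ℝ≥0) : ℝ≥0∞) *
          (2 * d * totalVar f U + 2 * d * (2 * C * ε)) := by
        gcongr
        refine key.trans (add_le_add (by gcongr) ?_)
        rw [ENNReal.ofReal_coe_nnreal]
        calc 3 * ENNReal.ofReal √d * C * ε ≤ 4 * d * C * ε := by
              gcongr
              norm_num
          _ = 2 * d * (2 * C * ε) := by ring
    _ = (((2 * d : ℝ≥0)⁻¹ * (2 * d) : ℝ≥0) : ℝ≥0∞) * (totalVar f U + 2 * C * ε) := by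
        push_cast
        ring
    _ = totalVar f U + 2 * C * ε := by
        rw [inv_mul_cancel₀ hdd, ENNReal.coe_one, one_mul]
    _ ≤ totalVar f U + ε' := by gcongr

end MVariation

theorem mainTheorem9 (d : ℕ) (hd : 1 ≤ d) (U : Set (MVariation.Space d))
    (hU : MVariation.IsLipschitzDomain U) (hUb : Bornology.IsBounded U) :
    ∃ C₁ C₂ : ℝ≥0, 0 < C₁ ∧ 0 < C₂ ∧
      ∀ f : MVariation.Space d → ℝ, ContinuousOn f (closure U) →
        MVariation.IsMonotoneOn f (closure U) →
        limsup (fun h : ℝ => (C₁ : ℝ≥0∞) * MVariation.gridMVarSum f U h) (𝓝[>] 0) ≤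
            MVariation.totalVar f U ∧
        ∀ h : ℝ, 0 < h →
          MVariation.totalVar f U ≤ (C₂ : ℝ≥0∞) * MVariation.gridMVarSum f U h := by
  have hd0 : (0 : ℝ≥0) < d := by exact_mod_cast hd
  exact ⟨(2 * d)⁻¹, 2 * d, by positivity, by positivity, fun f hc hf =>
    ⟨MVariation.limsup_gridMVarSum_le hd hU hUb hf hc, fun h hh =>
      MVariation.totalVar_le_gridMVarSum hd hU.1 hUb hf hc hh⟩⟩
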